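/- **Theorem.** Let $n,m\ge 1$ and $\mathbf x,\mathbf y\in\mathbb R^n$. Let $\mathbf G\in\mathbb R^{m\times n}$ have i.i.d. $\mathcal N(0,1)$ entries. Let $\mathbf G_{\mathrm{ort}}$ be the Gaussian orthogonal matrix: the square $n\times n$ version is obtained by taking as rows a uniformly (Haar) random orthonormal basis of $\mathbb R^n$ and scaling the rows by i.i.d. $\chi_n$-distributed factors independent of the basis (so that each row is marginally $\mathcal N(0,I_n)$); the $m\times n$ version consists of the first $m$ rows of a stack of independent copies of the square one (for $m\le n$: the first $m$ rows of one copy). Put $$\widehat K^{\mathrm{base}}_m(\mathbf x,\mathbf y)=\tfrac1m(\mathbf G\mathbf x)^\top(\mathbf G\mathbf y),\qquad \widehat K^{\mathrm{ort}}_m(\mathbf x,\mathbf y)=\tfrac1m(\mathbf G_{\mathrm{ort}}\mathbf x)^\top(\mathbf G_{\mathrm{ort}}\mathbf y),$$ and $\mathrm{MSE}(\widehat K)=\mathbb E\big[(\widehat K-\langle\mathbf x,\mathbf y\rangle)^2\big]$. Then $\widehat K^{\mathrm{ort}}_m$ is unbiased, i.e. it is integrable and $\mathbb E[\widehat K^{\mathrm{ort}}_m(\mathbf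 x,\mathbf y)]=\langle\mathbf x,\mathbf y\rangle$. If moreover $n\ge 4$ and $m\le n$, then both mean-squared errors are finite and $$\mathrm{MSE}(\widehat K^{\mathrm{ort}}_m(\mathbf x,\mathbf y))=\mathrm{MSE}(\widehat K^{\mathrm{base}}_m(\mathbf x,\mathbf y))+\frac{m-1}{m}\Bigg[\frac{\|\mathbf x\|_2^2\|\mathbf y\|_2^2\,n(n-2)}{2}\Bigg(\frac{\cos^2\theta+\frac12}{(n+2)(n-1)}+\frac{\cos^2\theta-\frac12}{(n-1)(n-2)}\Bigg)-\langle\mathbf x,\mathbf y\rangle^2\Bigg],$$ where $\theta$ is the angle between $\mathbf x$ and $\mathbf y$ (with $\theta=\pi/2$ if one of them is $0$). -/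

import Mathlib

open MeasureTheory ProbabilityTheory
open scoped Matrix

noncomputable section

namespace OJLT

/-- Measurable structure on real matrices: the product one, entry by entry. -/
instance instMeasurableSpaceMatrix (m n : ℕ) : MeasurableSpace (Matrix (Fin m) (Fin n) ℝ) :=
  inferInstanceAs (MeasurableSpace (Fin m → Fin n → ℝ))

instance instBorelSpaceMatrix (m n : ℕ) : BorelSpace (Matrix (Fin m) (Fin n) ℝ) :=
  inferInstanceAs (BorelSpace (Fin m → Fin n → ℝ))

/-- The orthogonal group `O(n)`, with the Borel structure induced from the matrices. -/
abbrev O (n : ℕ) : Type := Matrix.orthogonalGroup (Fin n) ℝ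

instance instMeasurableSpaceO (n : ℕ) : MeasurableSpace (O n) :=
  inferInstanceAs (MeasurableSpace
    {A : Matrix (Fin n) (Fin n) ℝ // A ∈ Matrix.orthogonalGroup (Fin n) ℝ})

instance instBorelSpaceO (n : ℕ) : BorelSpace (O n) :=
  inferInstanceAs (BorelSpace
    {A : Matrix (Fin n) (Fin n) ℝ // A ∈ Matrix.orthogonalGroup (Fin n) ℝ})

theorem isCompact_orthogonalGroup (n : ℕ) :
    IsCompact {A : Matrix (Fin n) (Fin n) ℝ | A ∈ Matrix.orthogonalGroup (Fin n) ℝ} := by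
  have hK : IsCompact
      ((Set.univ.pi fun _ => Set.univ.pi fun _ => Set.Icc (-1) 1 :
        Set (Fin n → Fin n → ℝ))) :=
    isCompact_univ_pi fun _ => isCompact_univ_pi fun _ => isCompact_Icc
  refine IsCompact.of_isClosed_subset (X := Matrix (Fin n) (Fin n) ℝ) hK ?_ ?_
  · have : {A : Matrix (Fin n) (Fin n) ℝ | A ∈ Matrix.orthogonalGroup (Fin n) ℝ}
        = {A | A * Aᵀ = 1} := by
      ext A
      exact Matrix.mem_orthogonalGroup_iff (Fin n) ℝ
    rw [this]
    exact isClosed_eq (by fun_prop) continuous_const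
  · intro A hA i _ j _
    have h := entry_norm_bound_of_unitary (𝕜 := ℝ) (U := A) hA i j
    rw [Real.norm_eq_abs] at h
    exact abs_le.mp h

instance instCompactSpaceO (n : ℕ) : CompactSpace (O n) :=
  isCompact_iff_compactSpace.mp (isCompact_orthogonalGroup n)

/-- The Haar probability measure on `O(n)`. The rows of a matrix with this law are a uniformly
random orthonormal basis of `ℝⁿ`. -/
def haarO (n : ℕ) : Measure (O n) := Measure.haarMeasure ⊤

instance instIsProbabilityMeasureHaarO (n : ℕ) : IsProbabilityMeasure (haarO n) :=
  ⟨Measure.haarMeasure_self (K₀ := (⊤ : TopologicalSpace.PositiveCompacts (O n)))⟩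

/-- The chi distribution with `n` degrees of freedom: the law of `‖g‖` for `g ∼ N(0, Iₙ)`. -/
def chiLaw (n : ℕ) : Measure ℝ :=
  (stdGaussian (EuclideanSpace ℝ (Fin n))).map fun g => ‖g‖

instance instIsProbabilityMeasureChiLaw (n : ℕ) : IsProbabilityMeasure (chiLaw n) :=
  Measure.isProbabilityMeasure_map (by fun_prop)

/-- The law of the unstructured `m × n` matrix `G` with i.i.d. `N(0,1)` entries. -/
def gaussianLaw (m n : ℕ) : Measure (Matrix (Fin m) (Fin n) ℝ) :=
  (Measure.pi fun _ : Fin m => Measure.pi fun _ : Fin n => gaussianReal 0 1 :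
    Measure (Fin m → Fin n → ℝ))

instance instIsProbabilityMeasureGaussianLaw (m n : ℕ) :
    IsProbabilityMeasure (gaussianLaw m n) :=
  inferInstanceAs (IsProbabilityMeasure
    (Measure.pi fun _ : Fin m => Measure.pi fun _ : Fin n => gaussianReal 0 1))

/-- Scale the `i`-th row of `U` by `s i`. -/
def scaleRows (n : ℕ) (p : O n × (Fin n → ℝ)) : Matrix (Fin n) (Fin n) ℝ :=
  Matrix.diagonal p.2 * p.1.1

theorem measurable_scaleRows (n : ℕ) : Measurable (scaleRows n) := by
  refine measurable_pi_lambda _ fun i => measurable_pi_lambda _ fun j => ?_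
  have h : (fun p : O n × (Fin n → ℝ) => scaleRows n p i j) = fun p => p.2 i * p.1.1 i j := by
    ext p
    simp [scaleRows, Matrix.diagonal_mul]
  rw [h]
  have h1 : Measurable fun p : O n × (Fin n → ℝ) => p.2 i :=
    (measurable_pi_apply i).comp measurable_snd
  have h2 : Measurable fun p : O n × (Fin n → ℝ) =>
      (show Fin n → Fin n → ℝ from p.1.1) i j :=
    (measurable_pi_apply j).comp ((measurable_pi_apply i).comp
      (measurable_subtype_coe.comp measurable_fst))
  exact h1.mul h2

/-- The law of the square matrix `G_ort`: the rows of a uniformly random orthonormal basis,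
scaled by i.i.d. chi variables with `n` degrees of freedom that are independent of the basis. -/
def gOrtSquareLaw (n : ℕ) : Measure (Matrix (Fin n) (Fin n) ℝ) :=
  ((haarO n).prod (Measure.pi fun _ : Fin n => chiLaw n)).map (scaleRows n)

instance instIsProbabilityMeasureGOrtSquareLaw (n : ℕ) :
    IsProbabilityMeasure (gOrtSquareLaw n) :=
  Measure.isProbabilityMeasure_map (measurable_scaleRows n).aemeasurable

/-- Stack square blocks on top of each other and keep the first `m` rows: row `i` is row `i % n`
of block number `i / n`. At most `m` blocks are used. -/
def stackRows (m n : ℕ) [NeZero n] (B : Fin m → Matrix (Fin n) (Fin n) ℝ) :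
    Matrix (Fin m) (Fin n) ℝ :=
  Matrix.of fun i j => B ⟨i.val / n, (Nat.div_le_self _ _).trans_lt i.isLt⟩ (Fin.ofNat n i.val) j

theorem measurable_stackRows (m n : ℕ) [NeZero n] : Measurable (stackRows m n) := by
  refine measurable_pi_lambda _ fun i => measurable_pi_lambda _ fun j => ?_
  have h : Measurable fun B : Fin m → Fin n → Fin n → ℝ =>
      B ⟨i.val / n, (Nat.div_le_self _ _).trans_lt i.isLt⟩ (Fin.ofNat n i.val) j :=
    (measurable_pi_apply j).comp ((measurable_pi_apply _).comp (measurable_pi_apply _))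
  exact h

/-- The law of the `m × n` matrix `G_ort`: independent copies of the square matrix are stacked and
superfluous rows deleted. For `m ≤ n` these are the first `m` rows of one square `G_ort`. -/
def gOrtLaw (m n : ℕ) [NeZero n] : Measure (Matrix (Fin m) (Fin n) ℝ) :=
  (Measure.pi fun _ : Fin m => gOrtSquareLaw n).map (stackRows m n)

instance instIsProbabilityMeasureGOrtLaw (m n : ℕ) [NeZero n] :
    IsProbabilityMeasure (gOrtLaw m n) :=
  Measure.isProbabilityMeasure_map (measurable_stackRows m n).aemeasurable

/-- The dot-product estimator `(1/m) (M x)ᵀ (M y)`. -/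
def estimator {m n : ℕ} (M : Matrix (Fin m) (Fin n) ℝ) (x y : EuclideanSpace ℝ (Fin n)) : ℝ :=
  1 / (m : ℝ) * ((M *ᵥ x.ofLp) ⬝ᵥ (M *ᵥ y.ofLp))

/-- The random variable `K` is an unbiased estimator of `v`. -/
def IsUnbiased {Ω : Type*} [MeasurableSpace Ω] (P : Measure Ω) (K : Ω → ℝ) (v : ℝ) : Prop :=
  Integrable K P ∧ ∫ ω, K ω ∂P = v

/-- The mean-squared error of the estimator `K` of `v`. -/
def mse {Ω : Type*} [MeasurableSpace Ω] (P : Measure Ω) (K : Ω → ℝ) (v : ℝ) : ℝ :=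
  ∫ ω, (K ω - v) ^ 2 ∂P

end OJLT

end

/-! Both estimators are averages of `m` terms `Z i = (M x)_i (M y)_i`, each with mean `⟨x, y⟩`. When
all `Z i` share one second moment `d` and all pairs `i ≠ j` share one mixed moment `o`, the error is
`(d + (m - 1) o) / m - ⟨x, y⟩²` (`mse_average`). The value `d = ‖x‖²‖y‖² + 2⟨x, y⟩²` is the same for
both matrices, and `o = ⟨x, y⟩²` for independent rows, so the two errors differ by `(m - 1)/m *
(o_ort - ⟨x, y⟩²)`.

For `m ≤ n` the structured rows come from one Haar matrix `U`, and the independent chi factors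
contribute `E[s²]² = n²`. It remains to find the Haar average of `u_i v_i u_j v_j` with `u = U x`,
`v = U y`. Let `a`, `b`, `c` be the averages of `u_i² v_i²`, `u_i² v_j²`, `u_i v_i u_j v_j`.
Permuting coordinates shows that they do not depend on the choice of `i ≠ j`. Preservation of norms
gives `n (a + (n - 1) b) = ‖x‖²‖y‖²`, preservation of dot products gives `n (a + (n - 1) c) = ⟨x,
y⟩²`, and invariance under mixing two coordinates at 45° gives `a = 2c + b`. This linear system
determines `a` and `c` without any explicit density. Partial fractions then put `o_ort` in the
stated form. -/

namespace OJLT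

/-! ### Sums over pairs -/

/-- This is how exchangeability gets used, both for sums over coordinates of a Haar vector and for
sums over rows of the estimator. -/
theorem sum_sum_eq_of_diag_of_offDiag {n : ℕ} (f : Fin n → Fin n → ℝ) (d o : ℝ)
    (hd : ∀ i, f i i = d) (ho : ∀ i j, i ≠ j → f i j = o) :
    ∑ i, ∑ j, f i j = n * (d + (n - 1) * o) := by
  have h : ∀ i j, f i j = o + if i = j then d - o else 0 := by
    intro i j
    by_cases hij : i = j
    · subst hij; simp [hd]
    · simp [hij, ho i j hij]
  simp only [h, Finset.sum_add_distrib, Finset.sum_ite_eq, Finset.mem_univ, if_true,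
    Finset.sum_const, Finset.card_univ, Fintype.card_fin, nsmul_eq_mul]
  ring

/-! ### Haar measure on the orthogonal group -/

instance instIsMulLeftInvariantHaarO (n : ℕ) : (haarO n).IsMulLeftInvariant := by
  unfold haarO; infer_instance

theorem continuous_coe_mulVec (n : ℕ) (x : Fin n → ℝ) :
    Continuous fun U : O n => U.1 *ᵥ x :=
  continuous_subtype_val.matrix_mulVec continuous_const

theorem integrable_haarO {n : ℕ} {f : O n → ℝ} (hf : Continuous f) : Integrable f (haarO n) :=
  hf.integrable_of_hasCompactSupport (HasCompactSupport.of_compactSpace f)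

theorem dotProduct_mulVec_mulVec {n : ℕ} (U : O n) (x y : Fin n → ℝ) :
    (U.1 *ᵥ x) ⬝ᵥ (U.1 *ᵥ y) = x ⬝ᵥ y := by
  have h : U.1ᵀ * U.1 = 1 := (Matrix.mem_orthogonalGroup_iff' (Fin n) ℝ).1 U.2
  rw [Matrix.dotProduct_mulVec, ← Matrix.mulVec_transpose, Matrix.mulVec_mulVec, h,
    Matrix.one_mulVec]

/-- Left invariance of Haar measure, for an arbitrary function of the pair `(U x, U y)`. All
symmetries needed below are special choices of `A`: permutation matrices and one reflection. -/
theorem integral_haarO_mulVec {n : ℕ} (A : O n) (x y : Fin n → ℝ)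
    (f : (Fin n → ℝ) → (Fin n → ℝ) → ℝ) :
    ∫ U, f (A.1 *ᵥ (U.1 *ᵥ x)) (A.1 *ᵥ (U.1 *ᵥ y)) ∂haarO n =
      ∫ U, f (U.1 *ᵥ x) (U.1 *ᵥ y) ∂haarO n := by
  rw [← integral_mul_left_eq_self (μ := haarO n) (fun U => f (U.1 *ᵥ x) (U.1 *ᵥ y)) A]
  simp [Matrix.mulVec_mulVec]

theorem permMatrix_mem_orthogonalGroup {n : ℕ} (σ : Equiv.Perm (Fin n)) :
    σ.permMatrix ℝ ∈ Matrix.orthogonalGroup (Fin n) ℝ := by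
  rw [Matrix.mem_orthogonalGroup_iff, Matrix.transpose_permMatrix, ← Matrix.permMatrix_mul]
  simp

theorem integral_haarO_perm {n : ℕ} (σ : Equiv.Perm (Fin n)) (x y : Fin n → ℝ)
    (f : (Fin n → ℝ) → (Fin n → ℝ) → ℝ) :
    ∫ U, f ((U.1 *ᵥ x) ∘ σ) ((U.1 *ᵥ y) ∘ σ) ∂haarO n =
      ∫ U, f (U.1 *ᵥ x) (U.1 *ᵥ y) ∂haarO n := by
  have h := integral_haarO_mulVec ⟨_, permMatrix_mem_orthogonalGroup σ⟩ x y f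
  simpa only [Matrix.permMatrix_mulVec] using h

/-- The Householder matrix `1 - t w wᵀ` is orthogonal when `t ‖w‖² = 2`. -/
theorem householder_mem_orthogonalGroup {n : ℕ} (w : Fin n → ℝ) (t : ℝ)
    (h : t * (w ⬝ᵥ w) = 2) :
    1 - t • Matrix.vecMulVec w w ∈ Matrix.orthogonalGroup (Fin n) ℝ := by
  rw [Matrix.mem_orthogonalGroup_iff]
  ext i j
  simp only [Matrix.transpose_sub, Matrix.transpose_one, Matrix.transpose_smul,
    Matrix.transpose_vecMulVec, sub_mul, mul_sub, one_mul, mul_one, Matrix.smul_mul,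
    Matrix.mul_smul, Matrix.vecMulVec_mul_vecMulVec, Matrix.sub_apply, Matrix.smul_apply,
    Matrix.vecMulVec_apply, Pi.smul_apply, smul_eq_mul]
  linear_combination t * w i * w j * h

theorem exists_orthogonal_rotation {n : ℕ} {i j : Fin n} (hij : i ≠ j) :
    ∃ A : O n, ∀ v : Fin n → ℝ, (A.1 *ᵥ v) i = √2 / 2 * (v i + v j) ∧
      (A.1 *ᵥ v) j = √2 / 2 * (v i - v j) := by
  have h2 : √2 * √2 = 2 := Real.mul_self_sqrt (by norm_num)
  -- The block `√2/2 * [[1, 1], [1, -1]]` is a reflection, and `w` spans its `-1` eigenspace. Since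
  -- `‖w‖² = 4 - 2√2`, the Householder factor is `2 / ‖w‖² = 1 + √2/2`.
  set w : Fin n → ℝ := Pi.single i (1 - √2) + Pi.single j 1 with hw
  have hwi : w i = 1 - √2 := by simp [hw, hij]
  have hwj : w j = 1 := by simp [hw, hij.symm]
  have hwv : ∀ v, w ⬝ᵥ v = (1 - √2) * v i + v j := by
    intro v; simp [hw, add_dotProduct]
  refine ⟨⟨_, householder_mem_orthogonalGroup w (1 + √2 / 2) ?_⟩, fun v => ?_⟩
  · rw [hwv, hwi, hwj]; linear_combination (√2 / 2) * h2
  · simp only [Matrix.sub_mulVec, Matrix.one_mulVec, Matrix.smul_mulVec, Matrix.vecMulVec_mulVec,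
      Pi.sub_apply, Pi.smul_apply, smul_eq_mul, MulOpposite.smul_eq_mul_unop,
      MulOpposite.unop_op, hwv, hwi, hwj]
    constructor
    · linear_combination (v j / 2 - √2 / 2 * v i) * h2
    · linear_combination (v i / 2) * h2

/-- After exchanging `i` and `k`, the image of `j` is still different from `k`, so swapping that
image with `l` leaves `k` in place. -/
theorem exists_perm_map_pair {α : Type*} [DecidableEq α] {i j k l : α} (hij : i ≠ j)
    (hkl : k ≠ l) : ∃ σ : Equiv.Perm α, σ i = k ∧ σ j = l := by
  refine ⟨Equiv.swap (Equiv.swap i k j) l * Equiv.swap i k, ?_, by simp⟩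
  simp only [Equiv.Perm.mul_apply, Equiv.swap_apply_left]
  refine Equiv.swap_apply_of_ne_of_ne ?_ hkl
  intro h
  have := congrArg (Equiv.swap i k) h
  simp at this
  exact hij this

theorem integral_haarO_eq_of_apply {n : ℕ} (x y : Fin n → ℝ) (f : ℝ → ℝ → ℝ) (i k : Fin n) :
    ∫ U, f ((U.1 *ᵥ x) i) ((U.1 *ᵥ y) i) ∂haarO n =
      ∫ U, f ((U.1 *ᵥ x) k) ((U.1 *ᵥ y) k) ∂haarO n := by
  simpa using (integral_haarO_perm (Equiv.swap i k) x y fun u v => f (u i) (v i)).symm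

theorem integral_haarO_eq_of_apply_pair {n : ℕ} (x y : Fin n → ℝ) (f : ℝ → ℝ → ℝ → ℝ → ℝ)
    {i j k l : Fin n} (hij : i ≠ j) (hkl : k ≠ l) :
    ∫ U, f ((U.1 *ᵥ x) i) ((U.1 *ᵥ x) j) ((U.1 *ᵥ y) i) ((U.1 *ᵥ y) j) ∂haarO n =
      ∫ U, f ((U.1 *ᵥ x) k) ((U.1 *ᵥ x) l) ((U.1 *ᵥ y) k) ((U.1 *ᵥ y) l) ∂haarO n := by
  obtain ⟨σ, rfl, rfl⟩ := exists_perm_map_pair hij hkl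
  simpa using (integral_haarO_perm σ x y fun u v => f (u i) (u j) (v i) (v j)).symm

/-- The `n` coordinate products have equal averages, and their sum is the constant `x ⬝ᵥ y`. -/
theorem integral_haarO_mul {n : ℕ} (x y : Fin n → ℝ) (i : Fin n) :
    n * ∫ U, (U.1 *ᵥ x) i * (U.1 *ᵥ y) i ∂haarO n = x ⬝ᵥ y := by
  have hx := continuous_coe_mulVec n x
  have hy := continuous_coe_mulVec n y
  have h : ∫ U, ∑ k, (U.1 *ᵥ x) k * (U.1 *ᵥ y) k ∂haarO n = x ⬝ᵥ y := by
    have : ∀ U : O n, ∑ k, (U.1 *ᵥ x) k * (U.1 *ᵥ y) k = x ⬝ᵥ y :=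
      fun U => dotProduct_mulVec_mulVec U x y
    simp [this]
  rw [integral_finsetSum _ fun k _ => integrable_haarO (by fun_prop)] at h
  rw [← h, Finset.sum_congr rfl fun k _ => integral_haarO_eq_of_apply x y (· * ·) k i]
  simp

/-! ### Fourth-order moments of two coordinates under Haar measure -/

section FourthMoments

variable {n : ℕ} (x y : Fin n → ℝ) {i j : Fin n}

/-- First linear equation: expand `‖U x‖² ‖U y‖²`, which is constant in `U`, and group its terms by
exchangeability. -/
theorem integral_haarO_sq_mul_sq_sum (hij : i ≠ j) :
    n * (∫ U, (U.1 *ᵥ x) i ^ 2 * (U.1 *ᵥ y) i ^ 2 ∂haarO n +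
      (n - 1) * ∫ U, (U.1 *ᵥ x) i ^ 2 * (U.1 *ᵥ y) j ^ 2 ∂haarO n) =
      (x ⬝ᵥ x) * (y ⬝ᵥ y) := by
  have hx := continuous_coe_mulVec n x
  have hy := continuous_coe_mulVec n y
  rw [← sum_sum_eq_of_diag_of_offDiag
    (fun k l => ∫ U, (U.1 *ᵥ x) k ^ 2 * (U.1 *ᵥ y) l ^ 2 ∂haarO n) _ _
    (fun k => integral_haarO_eq_of_apply x y (fun a b => a ^ 2 * b ^ 2) k i)
    (fun k l hkl => integral_haarO_eq_of_apply_pair x y (fun a _ _ d => a ^ 2 * d ^ 2) hkl hij)]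
  have h : ∀ U : O n, ∑ k, ∑ l, (U.1 *ᵥ x) k ^ 2 * (U.1 *ᵥ y) l ^ 2 =
      (x ⬝ᵥ x) * (y ⬝ᵥ y) := fun U => by
    rw [← Finset.sum_mul_sum, ← dotProduct_mulVec_mulVec U x x, ← dotProduct_mulVec_mulVec U y y]
    simp only [dotProduct, sq]
  have h' := integral_congr_ae (μ := haarO n) (.of_forall h)
  rw [integral_finsetSum _ fun k _ => integrable_haarO (by fun_prop)] at h'
  rw [Finset.sum_congr rfl fun k _ => (integral_finsetSum _ fun l _ =>
    integrable_haarO (by fun_prop)).symm, h']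
  simp

/-- Second linear equation: the same expansion of the constant `(U x ⬝ᵥ U y)²`. -/
theorem integral_haarO_mul_mul_mul_sum (hij : i ≠ j) :
    n * (∫ U, (U.1 *ᵥ x) i ^ 2 * (U.1 *ᵥ y) i ^ 2 ∂haarO n +
      (n - 1) * ∫ U, (U.1 *ᵥ x) i * (U.1 *ᵥ y) i * ((U.1 *ᵥ x) j * (U.1 *ᵥ y) j) ∂haarO n) =
      (x ⬝ᵥ y) ^ 2 := by
  have hx := continuous_coe_mulVec n x
  have hy := continuous_coe_mulVec n y
  rw [← sum_sum_eq_of_diag_of_offDiag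
    (fun k l => ∫ U, (U.1 *ᵥ x) k * (U.1 *ᵥ y) k * ((U.1 *ᵥ x) l * (U.1 *ᵥ y) l) ∂haarO n) _ _
    (fun k => (integral_haarO_eq_of_apply x y (fun a b => a * b * (a * b)) k i).trans
      (by congr 1 with U; ring))
    (fun k l hkl => integral_haarO_eq_of_apply_pair x y (fun a b c d => a * c * (b * d)) hkl hij)]
  have h : ∀ U : O n, ∑ k, ∑ l, (U.1 *ᵥ x) k * (U.1 *ᵥ y) k * ((U.1 *ᵥ x) l * (U.1 *ᵥ y) l) =
      (x ⬝ᵥ y) ^ 2 := fun U => by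
    rw [← Finset.sum_mul_sum, ← dotProduct_mulVec_mulVec U x y, sq]
    simp only [dotProduct]
  have h' := integral_congr_ae (μ := haarO n) (.of_forall h)
  rw [integral_finsetSum _ fun k _ => integrable_haarO (by fun_prop)] at h'
  rw [Finset.sum_congr rfl fun k _ => (integral_finsetSum _ fun l _ =>
    integrable_haarO (by fun_prop)).symm, h']
  simp

/-- Third linear equation. Under the 45° mixing of coordinates `i` and `j`, `u_i u_j` becomes `(u_i²
- u_j²)/2`, and likewise for `v`. Hence `u_i v_i u_j v_j` has the same average as `(u_i² -
u_j²)(v_i² - v_j²)/4`, namely `(a - b)/2`. -/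
theorem integral_haarO_rotation (hij : i ≠ j) :
    ∫ U, (U.1 *ᵥ x) i ^ 2 * (U.1 *ᵥ y) i ^ 2 ∂haarO n =
      2 * ∫ U, (U.1 *ᵥ x) i * (U.1 *ᵥ y) i * ((U.1 *ᵥ x) j * (U.1 *ᵥ y) j) ∂haarO n +
      ∫ U, (U.1 *ᵥ x) i ^ 2 * (U.1 *ᵥ y) j ^ 2 ∂haarO n := by
  have hx := continuous_coe_mulVec n x
  have hy := continuous_coe_mulVec n y
  obtain ⟨A, hA⟩ := exists_orthogonal_rotation hij
  have h2 : √2 ^ 2 = 2 := Real.sq_sqrt (by norm_num)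
  have h := integral_haarO_mulVec A x y fun u v => u i * v i * (u j * v j)
  have hexp : ∀ a b c d : ℝ, √2 / 2 * (a + b) * (√2 / 2 * (c + d)) *
      (√2 / 2 * (a - b) * (√2 / 2 * (c - d))) =
      1 / 4 * (a ^ 2 * c ^ 2 + b ^ 2 * d ^ 2 - a ^ 2 * d ^ 2 - b ^ 2 * c ^ 2) := by
    intro a b c d
    have h4 : √2 ^ 4 = 4 := by rw [show 4 = 2 * 2 from rfl, pow_mul, h2]; norm_num
    linear_combination (1 / 16 * (a + b) * (c + d) * (a - b) * (c - d)) * h4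
  simp only [hA, hexp] at h
  rw [integral_const_mul, integral_sub (integrable_haarO (by fun_prop))
    (integrable_haarO (by fun_prop)), integral_sub (integrable_haarO (by fun_prop))
    (integrable_haarO (by fun_prop)), integral_add (integrable_haarO (by fun_prop))
    (integrable_haarO (by fun_prop)),
    integral_haarO_eq_of_apply x y (fun a b => a ^ 2 * b ^ 2) j i,
    integral_haarO_eq_of_apply_pair x y (fun a _ _ d => a ^ 2 * d ^ 2) hij.symm hij] at h
  linear_combination 2 * h

theorem integral_haarO_mul_mul_mul (hij : i ≠ j) :
    n * (n - 1) * (n + 2) *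
      ∫ U, (U.1 *ᵥ x) i * (U.1 *ᵥ y) i * ((U.1 *ᵥ x) j * (U.1 *ᵥ y) j) ∂haarO n =
      n * (x ⬝ᵥ y) ^ 2 - (x ⬝ᵥ x) * (y ⬝ᵥ y) := by
  have h1 := integral_haarO_sq_mul_sq_sum x y hij
  have h2 := integral_haarO_mul_mul_mul_sum x y hij
  have h3 := integral_haarO_rotation x y hij
  rw [h3] at h1 h2
  linear_combination n * h2 - h1

theorem integral_haarO_sq_mul_sq (hij : i ≠ j) :
    n * (n + 2) * ∫ U, (U.1 *ᵥ x) i ^ 2 * (U.1 *ᵥ y) i ^ 2 ∂haarO n =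
      (x ⬝ᵥ x) * (y ⬝ᵥ y) + 2 * (x ⬝ᵥ y) ^ 2 := by
  have h1 := integral_haarO_sq_mul_sq_sum x y hij
  have h2 := integral_haarO_mul_mul_mul_sum x y hij
  have h3 := integral_haarO_rotation x y hij
  linear_combination h1 + 2 * h2 + n * (n - 1) * h3

end FourthMoments

/-! ### Gaussian moments -/

theorem iteratedDeriv_four_exp_sq (c : ℝ) :
    iteratedDeriv 4 (fun t : ℝ => Real.exp (c * t ^ 2 / 2)) 0 = 3 * c ^ 2 := by
  have hE : ∀ t : ℝ, HasDerivAt (fun t : ℝ => Real.exp (c * t ^ 2 / 2))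
      (Real.exp (c * t ^ 2 / 2) * (c * t)) t := by
    intro t
    have := (((hasDerivAt_pow 2 t).const_mul c).div_const 2).exp
    convert this using 2
    norm_num
    ring
  -- Each derivative stays of the form polynomial times the same exponential, with `p` replaced by
  -- `p' + c t p`. From `1` the polynomials are `c t`, `c + c² t²`, `3c² t + c³ t³`, and then one
  -- with constant term `3c²`.
  have step : ∀ p p' : ℝ → ℝ, (∀ t, HasDerivAt p (p' t) t) →
      deriv (fun t => p t * Real.exp (c * t ^ 2 / 2)) =
        fun t => (p' t + c * t * p t) * Real.exp (c * t ^ 2 / 2) := by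
    intro p p' hp
    ext t
    have h := ((hp t).mul (hE t)).deriv
    refine Eq.trans h ?_
    ring
  have h0 : (fun t : ℝ => Real.exp (c * t ^ 2 / 2)) =
      fun t => (fun _ => (1 : ℝ)) t * Real.exp (c * t ^ 2 / 2) := by simp
  rw [iteratedDeriv_eq_iterate]
  simp only [Function.iterate_succ, Function.iterate_zero, Function.comp_apply, id_eq]
  rw [h0, step _ (fun _ => 0) fun t => hasDerivAt_const t 1,
    step _ (fun _ => c) fun t => by simpa using (hasDerivAt_id t).const_mul c,
    step _ (fun t => 2 * c ^ 2 * t) fun t => by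
      have h := (hasDerivAt_pow 2 t).const_mul (c ^ 2)
      convert! h.const_add c using 1
      · ext s; simp; ring
      · norm_num; ring,
    step _ (fun t => 3 * c ^ 2 + 3 * c ^ 3 * t ^ 2) fun t => by
      have h := ((hasDerivAt_id t).const_mul (3 * c ^ 2)).add
        ((hasDerivAt_pow 3 t).const_mul (c ^ 3))
      convert! h using 1
      · ext s; simp; ring
      · norm_num; ring]
  simp

theorem integral_pow_four_gaussianReal (v : NNReal) :
    ∫ t, t ^ 4 ∂gaussianReal 0 v = 3 * (v : ℝ) ^ 2 := by
  have h := iteratedDeriv_mgf_zero (X := id) (μ := gaussianReal 0 v)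
    (by simp [integrableExpSet_id_gaussianReal]) 4
  rw [mgf_id_gaussianReal] at h
  simp only [zero_mul, zero_add, iteratedDeriv_four_exp_sq] at h
  simpa using h.symm

section StdGaussian

variable {E : Type*} [NormedAddCommGroup E] [InnerProductSpace ℝ E] [FiniteDimensional ℝ E]
  [MeasurableSpace E] [BorelSpace E]

theorem memLp_inner_stdGaussian (x : E) {p : ENNReal} (hp : p ≠ ⊤) :
    MemLp (fun g => inner ℝ x g) p (stdGaussian E) :=
  IsGaussian.memLp_dual (stdGaussian E) (innerSL ℝ x) p hp

/-- The linear form `⟨x, g⟩` has law `N(0, ‖x‖²)`, so the one-dimensional fourth moment applies. -/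
theorem integral_inner_pow_four_stdGaussian (x : E) :
    ∫ g, (inner ℝ x g : ℝ) ^ 4 ∂stdGaussian E = 3 * ‖x‖ ^ 4 := by
  have hmap := IsGaussian.map_eq_gaussianReal (μ := stdGaussian E) (innerSL ℝ x)
  rw [integral_strongDual_stdGaussian, variance_dual_stdGaussian, innerSL_apply_norm] at hmap
  have h := integral_pow_four_gaussianReal (‖x‖ ^ 2).toNNReal
  rw [← hmap, integral_map (by fun_prop) (by fun_prop), Real.coe_toNNReal _ (by positivity)] at h
  simpa [← pow_mul] using h

theorem integral_inner_mul_inner_stdGaussian (x y : E) :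
    ∫ g, (inner ℝ x g : ℝ) * inner ℝ y g ∂stdGaussian E = inner ℝ x y := by
  have h := covarianceBilin_apply (μ := stdGaussian E) IsGaussian.memLp_two_id x y
  rw [covarianceBilin_stdGaussian] at h
  simpa [innerSL_apply_apply ℝ] using h.symm

theorem integrable_inner_mul_inner_stdGaussian (x y : E) :
    Integrable (fun g => (inner ℝ x g : ℝ) * inner ℝ y g) (stdGaussian E) :=
  (memLp_inner_stdGaussian x (p := 2) (by simp)).integrable_mul
    (memLp_inner_stdGaussian y (p := 2) (by simp))

theorem memLp_inner_mul_inner_stdGaussian (x y : E) :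
    MemLp (fun g => (inner ℝ x g : ℝ) * inner ℝ y g) 2 (stdGaussian E) := by
  have : ENNReal.HolderTriple 4 4 2 := ⟨by
    rw [show (4 : ENNReal) = 2 * 2 by norm_num, ENNReal.mul_inv (by simp) (by simp), ← two_mul,
      ← mul_assoc, ENNReal.mul_inv_cancel (by simp) (by simp), one_mul]⟩
  exact (memLp_inner_stdGaussian y (p := 4) (by simp)).mul'
    (memLp_inner_stdGaussian x (p := 4) (by simp))

theorem integrable_inner_sq_mul_inner_sq_stdGaussian (x y : E) :
    Integrable (fun g => (inner ℝ x g : ℝ) ^ 2 * (inner ℝ y g) ^ 2) (stdGaussian E) := by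
  simpa [mul_pow] using (memLp_inner_mul_inner_stdGaussian x y).integrable_sq

theorem integral_inner_sq_mul_inner_sq_stdGaussian (x y : E) :
    ∫ g, (inner ℝ x g : ℝ) ^ 2 * (inner ℝ y g) ^ 2 ∂stdGaussian E =
      ‖x‖ ^ 2 * ‖y‖ ^ 2 + 2 * (inner ℝ x y) ^ 2 := by
  have h4 : ∀ z : E, Integrable (fun g => (inner ℝ z g : ℝ) ^ 4) (stdGaussian E) := fun z => by
    simpa only [← pow_add] using integrable_inner_sq_mul_inner_sq_stdGaussian z z
  -- Polarization, from `(a + b)⁴ + (a - b)⁴ = 2a⁴ + 12a²b² + 2b⁴`, reduces the mixed moment to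
  -- fourth powers of single linear forms.
  have hpol : ∀ g : E, (inner ℝ x g : ℝ) ^ 2 * (inner ℝ y g) ^ 2 =
      1 / 12 * ((inner ℝ (x + y) g) ^ 4 + (inner ℝ (x - y) g) ^ 4 -
        (2 * (inner ℝ x g) ^ 4 + 2 * (inner ℝ y g) ^ 4)) := by
    intro g
    rw [inner_add_left, inner_sub_left]
    ring
  simp_rw [hpol]
  have h4c : ∀ z : E, Integrable (fun g => 2 * (inner ℝ z g : ℝ) ^ 4) (stdGaussian E) :=
    fun z => (h4 z).const_mul 2
  rw [integral_const_mul, integral_sub (by exact (h4 _).add (h4 _)) (by exact (h4c _).add (h4c _)),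
    integral_add (h4 _) (h4 _), integral_add (h4c _) (h4c _), integral_const_mul,
    integral_const_mul]
  simp only [integral_inner_pow_four_stdGaussian]
  have hp := norm_add_sq_real x y
  have hm := norm_sub_sq_real x y
  rw [show ‖x + y‖ ^ 4 = (‖x + y‖ ^ 2) ^ 2 by ring, show ‖x - y‖ ^ 4 = (‖x - y‖ ^ 2) ^ 2 by ring,
    hp, hm]
  ring

end StdGaussian

/-! ### Moments of the chi distribution -/

theorem integrable_sq_chiLaw (n : ℕ) : Integrable (fun s : ℝ => s ^ 2) (chiLaw n) := by
  rw [chiLaw, integrable_map_measure (by fun_prop) (by fun_prop)]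
  exact (IsGaussian.memLp_id (stdGaussian _) 2 (by simp)).norm.integrable_sq

theorem integrable_pow_four_chiLaw (n : ℕ) : Integrable (fun s : ℝ => s ^ 4) (chiLaw n) := by
  rw [chiLaw, integrable_map_measure (by fun_prop) (by fun_prop)]
  exact (IsGaussian.memLp_id (stdGaussian _) 4 (by simp)).integrable_norm_pow (by simp)

theorem integral_sq_chiLaw (n : ℕ) : ∫ s, s ^ 2 ∂chiLaw n = n := by
  rw [chiLaw, integral_map (by fun_prop) (by fun_prop)]
  simp_rw [← (EuclideanSpace.basisFun (Fin n) ℝ).sum_sq_inner_right, sq]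
  rw [integral_finsetSum _ fun i _ => integrable_inner_mul_inner_stdGaussian _ _]
  simp_rw [integral_inner_mul_inner_stdGaussian, OrthonormalBasis.inner_eq_ite]
  simp

/-- Expanding `‖g‖⁴` in an orthonormal basis, each of the `n²` pairs contributes `1`, and each of
the `n` diagonal pairs a further `2`. -/
theorem integral_pow_four_chiLaw (n : ℕ) : ∫ s, s ^ 4 ∂chiLaw n = n * (n + 2) := by
  rw [chiLaw, integral_map (by fun_prop) (by fun_prop)]
  simp_rw [show ∀ g : EuclideanSpace ℝ (Fin n), ‖g‖ ^ 4 = ‖g‖ ^ 2 * ‖g‖ ^ 2 by intro; ring,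
    ← (EuclideanSpace.basisFun (Fin n) ℝ).sum_sq_inner_right, Finset.sum_mul_sum]
  rw [integral_finsetSum _ fun i _ => integrable_finsetSum _ fun j _ =>
    integrable_inner_sq_mul_inner_sq_stdGaussian _ _]
  simp_rw [integral_finsetSum Finset.univ fun j _ =>
    integrable_inner_sq_mul_inner_sq_stdGaussian (EuclideanSpace.basisFun (Fin n) ℝ _)
      (EuclideanSpace.basisFun (Fin n) ℝ j), integral_inner_sq_mul_inner_sq_stdGaussian,
    OrthonormalBasis.norm_eq_one, OrthonormalBasis.inner_eq_ite]
  simp [Finset.sum_add_distrib, ite_pow, mul_ite]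
  ring

/-! ### Mean-squared error of an average -/

section Average

variable {Ω : Type*} {m : ℕ}

theorem average_sub_sq_eq (Z : Fin m → Ω → ℝ) (v : ℝ) (ω : Ω) :
    (1 / (m : ℝ) * ∑ i, Z i ω - v) ^ 2 =
      1 / (m : ℝ) ^ 2 * ∑ i, ∑ j, Z i ω * Z j ω - 2 * v * (1 / (m : ℝ) * ∑ i, Z i ω) + v ^ 2 := by
  rw [← Finset.sum_mul_sum]
  ring

variable [MeasurableSpace Ω] {P : Measure Ω} {Z : Fin m → Ω → ℝ} {v : ℝ}

theorem isUnbiased_average (hm : 1 ≤ m) (hZ : ∀ i, Integrable (Z i) P)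
    (hv : ∀ i, ∫ ω, Z i ω ∂P = v) : IsUnbiased P (fun ω => 1 / (m : ℝ) * ∑ i, Z i ω) v := by
  have hm0 : (m : ℝ) ≠ 0 := by positivity
  refine ⟨(integrable_finsetSum _ fun i _ => hZ i).const_mul _, ?_⟩
  rw [integral_const_mul, integral_finsetSum _ fun i _ => hZ i]
  simp [hv, hm0]

variable [IsProbabilityMeasure P]

theorem integrable_average_sub_sq (hZ : ∀ i, Integrable (Z i) P)
    (hZZ : ∀ i j, Integrable (fun ω => Z i ω * Z j ω) P) :
    Integrable (fun ω => (1 / (m : ℝ) * ∑ i, Z i ω - v) ^ 2) P := by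
  simp_rw [average_sub_sq_eq]
  exact ((((integrable_finsetSum _ fun i _ => integrable_finsetSum _ fun j _ =>
    hZZ i j).const_mul _).sub (((integrable_finsetSum _ fun i _ => hZ i).const_mul _).const_mul
    _)).add (integrable_const _))

/-- Expanding the square leaves only first and second moments. No independence is assumed, so the
formula covers both matrices. -/
theorem mse_average (hm : 1 ≤ m) (hZ : ∀ i, Integrable (Z i) P) (hv : ∀ i, ∫ ω, Z i ω ∂P = v)
    (hZZ : ∀ i j, Integrable (fun ω => Z i ω * Z j ω) P) {d o : ℝ}
    (hd : ∀ i, ∫ ω, Z i ω * Z i ω ∂P = d) (ho : ∀ i j, i ≠ j → ∫ ω, Z i ω * Z j ω ∂P = o) :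
    mse P (fun ω => 1 / (m : ℝ) * ∑ i, Z i ω) v = (d + (m - 1) * o) / m - v ^ 2 := by
  have hm0 : (m : ℝ) ≠ 0 := by positivity
  obtain ⟨hI, hE⟩ := isUnbiased_average hm hZ hv
  have hS : Integrable (fun ω => ∑ i, ∑ j, Z i ω * Z j ω) P :=
    integrable_finsetSum _ fun i _ => integrable_finsetSum _ fun j _ => hZZ i j
  simp only [mse, average_sub_sq_eq]
  rw [integral_add (by exact (hS.const_mul _).sub (hI.const_mul _)) (integrable_const _),
    integral_sub (hS.const_mul _) (hI.const_mul _), integral_const_mul, integral_const_mul, hE,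
    integral_finsetSum _ fun i _ => integrable_finsetSum _ fun j _ => hZZ i j,
    Finset.sum_congr rfl fun i _ => integral_finsetSum _ fun j _ => hZZ i j,
    sum_sum_eq_of_diag_of_offDiag _ d o hd ho]
  simp
  field_simp
  ring

end Average

/-! ### Independent coordinates -/

section Pi

variable {ι α : Type*} [Fintype ι] [MeasurableSpace α] {μ : Measure α} [IsProbabilityMeasure μ]
  {f g : α → ℝ} {i j : ι}

theorem indepFun_pi_eval (hf : Integrable f μ) (hg : Integrable g μ) (hij : i ≠ j) :
    IndepFun (fun ω : ι → α => f (ω i)) (fun ω => g (ω j)) (Measure.pi fun _ => μ) := by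
  classical
  -- A full family is needed to invoke independence of coordinates; only its members at `i` and `j`
  -- matter, and `j ≠ i` makes the latter `g`.
  have h := (iIndepFun_pi (μ := fun _ : ι => μ) (X := fun k => if k = i then f else g)
    fun k => by split_ifs; exacts [hf.aemeasurable, hg.aemeasurable]).indepFun hij
  simpa [hij.symm] using h

theorem integrable_pi_mul (hf : Integrable f μ) (hg : Integrable g μ) (hij : i ≠ j) :
    Integrable (fun ω : ι → α => f (ω i) * g (ω j)) (Measure.pi fun _ => μ) :=
  (indepFun_pi_eval hf hg hij).integrable_mul (integrable_comp_eval hf) (integrable_comp_eval hg)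

theorem integral_pi_mul (hf : Integrable f μ) (hg : Integrable g μ) (hij : i ≠ j) :
    ∫ ω : ι → α, f (ω i) * g (ω j) ∂(Measure.pi fun _ => μ) = (∫ a, f a ∂μ) * ∫ a, g a ∂μ := by
  rw [(indepFun_pi_eval hf hg hij).integral_fun_mul_eq_mul_integral
    (integrable_comp_eval hf).aestronglyMeasurable (integrable_comp_eval hg).aestronglyMeasurable,
    integral_comp_eval (μ := fun _ : ι => μ) hf.aestronglyMeasurable,
    integral_comp_eval (μ := fun _ : ι => μ) hg.aestronglyMeasurable]

end Pi

/-! ### The summands of the estimator -/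

/-- The contribution `(M x)ᵢ (M y)ᵢ` of row `i` to the estimator. -/
def rowTerm {m n : ℕ} (x y : EuclideanSpace ℝ (Fin n)) (i : Fin m)
    (M : Matrix (Fin m) (Fin n) ℝ) : ℝ :=
  (M *ᵥ x.ofLp) i * (M *ᵥ y.ofLp) i

theorem estimator_eq_average {m n : ℕ} (M : Matrix (Fin m) (Fin n) ℝ)
    (x y : EuclideanSpace ℝ (Fin n)) :
    estimator M x y = 1 / (m : ℝ) * ∑ i, rowTerm x y i M := rfl

theorem continuous_rowTerm {m n : ℕ} (x y : EuclideanSpace ℝ (Fin n)) (i : Fin m) :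
    Continuous (rowTerm (m := m) x y i) := by
  have h : ∀ z : Fin n → ℝ, Continuous fun M : Matrix (Fin m) (Fin n) ℝ => (M *ᵥ z) i :=
    fun z => (continuous_apply i).comp (continuous_id.matrix_mulVec continuous_const)
  exact (h _).mul (h _)

theorem measurable_rowTerm {m n : ℕ} (x y : EuclideanSpace ℝ (Fin n)) (i : Fin m) :
    Measurable (rowTerm (m := m) x y i) :=
  (continuous_rowTerm x y i).measurable

theorem measurable_rowTerm_mul_rowTerm {m n : ℕ} (x y : EuclideanSpace ℝ (Fin n)) (i j : Fin m) :
    Measurable fun M => rowTerm x y i M * rowTerm x y j M :=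
  (measurable_rowTerm x y i).mul (measurable_rowTerm x y j)

theorem ofLp_dotProduct_ofLp {n : ℕ} (x y : EuclideanSpace ℝ (Fin n)) :
    x.ofLp ⬝ᵥ y.ofLp = inner ℝ x y := by
  simp [EuclideanSpace.inner_eq_star_dotProduct, dotProduct_comm]

/-! ### Unstructured Gaussian rows -/

section GaussianRows

variable {n : ℕ}

/-- The law of a single row of the unstructured matrix. -/
noncomputable abbrev gaussianRowLaw (n : ℕ) : Measure (Fin n → ℝ) :=
  Measure.pi fun _ : Fin n => gaussianReal 0 1

theorem hasLaw_toLp_gaussianRowLaw :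
    HasLaw (WithLp.toLp 2) (stdGaussian (EuclideanSpace ℝ (Fin n))) (gaussianRowLaw n) :=
  ⟨by fun_prop, map_pi_eq_stdGaussian⟩

variable (x y : EuclideanSpace ℝ (Fin n))

/-- The contribution of a row `r` to the estimator. -/
abbrev rowProd (r : Fin n → ℝ) : ℝ := (r ⬝ᵥ x.ofLp) * (r ⬝ᵥ y.ofLp)

theorem rowProd_eq (r : Fin n → ℝ) :
    rowProd x y r = inner ℝ x (WithLp.toLp 2 r) * inner ℝ y (WithLp.toLp 2 r) := by
  simp [rowProd, ← ofLp_dotProduct_ofLp, dotProduct_comm]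

theorem integrable_rowProd : Integrable (rowProd x y) (gaussianRowLaw n) := by
  have h := integrable_inner_mul_inner_stdGaussian x y
  rw [← hasLaw_toLp_gaussianRowLaw.map_eq, integrable_map_measure (by fun_prop) (by fun_prop)] at h
  exact h.congr (.of_forall fun r => (rowProd_eq x y r).symm)

theorem integral_rowProd : ∫ r, rowProd x y r ∂gaussianRowLaw n = inner ℝ x y := by
  rw [← integral_inner_mul_inner_stdGaussian x y,
    ← hasLaw_toLp_gaussianRowLaw.integral_comp (by fun_prop)]
  simp only [rowProd_eq, Function.comp_apply]

theorem integrable_rowProd_mul_self :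
    Integrable (fun r => rowProd x y r * rowProd x y r) (gaussianRowLaw n) := by
  have h := integrable_inner_sq_mul_inner_sq_stdGaussian x y
  rw [← hasLaw_toLp_gaussianRowLaw.map_eq, integrable_map_measure (by fun_prop) (by fun_prop)] at h
  refine h.congr (.of_forall fun r => ?_)
  simp only [rowProd_eq, Function.comp_apply]
  ring

theorem integral_rowProd_mul_self :
    ∫ r, rowProd x y r * rowProd x y r ∂gaussianRowLaw n =
      ‖x‖ ^ 2 * ‖y‖ ^ 2 + 2 * (inner ℝ x y) ^ 2 := by
  rw [← integral_inner_sq_mul_inner_sq_stdGaussian x y,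
    ← hasLaw_toLp_gaussianRowLaw.integral_comp (by fun_prop)]
  simp only [rowProd_eq, Function.comp_apply]
  congr 1 with r
  ring

variable {m : ℕ} (i j : Fin m)

theorem integrable_rowTerm_gaussianLaw : Integrable (rowTerm x y i) (gaussianLaw m n) :=
  integrable_comp_eval (μ := fun _ : Fin m => gaussianRowLaw n) (integrable_rowProd x y)

theorem integral_rowTerm_gaussianLaw :
    ∫ M, rowTerm x y i M ∂gaussianLaw m n = inner ℝ x y :=
  (integral_comp_eval (μ := fun _ : Fin m => gaussianRowLaw n) (i := i)
    (integrable_rowProd x y).aestronglyMeasurable).trans (integral_rowProd x y)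

theorem integrable_rowTerm_mul_rowTerm_gaussianLaw :
    Integrable (fun M => rowTerm x y i M * rowTerm x y j M) (gaussianLaw m n) := by
  by_cases hij : i = j
  · subst hij
    exact integrable_comp_eval (μ := fun _ : Fin m => gaussianRowLaw n)
      (integrable_rowProd_mul_self x y)
  · exact integrable_pi_mul (integrable_rowProd x y) (integrable_rowProd x y) hij

theorem integral_rowTerm_mul_self_gaussianLaw :
    ∫ M, rowTerm x y i M * rowTerm x y i M ∂gaussianLaw m n =
      ‖x‖ ^ 2 * ‖y‖ ^ 2 + 2 * (inner ℝ x y) ^ 2 :=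
  (integral_comp_eval (μ := fun _ : Fin m => gaussianRowLaw n) (i := i)
    (integrable_rowProd_mul_self x y).aestronglyMeasurable).trans (integral_rowProd_mul_self x y)

variable {i j} in
theorem integral_rowTerm_mul_rowTerm_gaussianLaw (hij : i ≠ j) :
    ∫ M, rowTerm x y i M * rowTerm x y j M ∂gaussianLaw m n = (inner ℝ x y) ^ 2 := by
  refine (integral_pi_mul (integrable_rowProd x y) (integrable_rowProd x y) hij).trans ?_
  rw [integral_rowProd, sq]

end GaussianRows

/-! ### Rows of the Gaussian orthogonal matrix -/

section OrthogonalRows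

variable {n : ℕ} (x y : EuclideanSpace ℝ (Fin n)) {i j : Fin n}

/-- The scaling enters both factors of the row term, hence as a square, and separates from the
basis. Moments under the product measure therefore split into a Haar part and a chi part. -/
theorem rowTerm_scaleRows (i : Fin n) (p : O n × (Fin n → ℝ)) :
    rowTerm x y i (scaleRows n p) =
      ((p.1.1 *ᵥ x.ofLp) i * (p.1.1 *ᵥ y.ofLp) i) * p.2 i ^ 2 := by
  simp only [rowTerm, scaleRows, ← Matrix.mulVec_mulVec, Matrix.mulVec_diagonal]
  ring

theorem integrable_rowTerm_gOrtSquareLaw (i : Fin n) :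
    Integrable (rowTerm x y i) (gOrtSquareLaw n) := by
  have hx := continuous_coe_mulVec n x.ofLp
  have hy := continuous_coe_mulVec n y.ofLp
  rw [gOrtSquareLaw, integrable_map_measure (measurable_rowTerm x y i).aestronglyMeasurable
    (measurable_scaleRows n).aemeasurable]
  have h := (integrable_haarO (n := n) (f := fun U => (U.1 *ᵥ x.ofLp) i * (U.1 *ᵥ y.ofLp) i)
    (by fun_prop)).mul_prod
    (integrable_comp_eval (μ := fun _ : Fin n => chiLaw n) (i := i) (integrable_sq_chiLaw n))
  exact h.congr (.of_forall fun p => (rowTerm_scaleRows x y i p).symm)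

theorem integral_rowTerm_gOrtSquareLaw (i : Fin n) :
    ∫ M, rowTerm x y i M ∂gOrtSquareLaw n = inner ℝ x y := by
  rw [gOrtSquareLaw, integral_map (measurable_scaleRows n).aemeasurable
    (measurable_rowTerm x y i).aestronglyMeasurable]
  simp_rw [rowTerm_scaleRows]
  rw [integral_prod_mul (fun U : O n => (U.1 *ᵥ x.ofLp) i * (U.1 *ᵥ y.ofLp) i)
      (fun s : Fin n → ℝ => s i ^ 2),
    integral_comp_eval (μ := fun _ : Fin n => chiLaw n) (f := fun s : ℝ => s ^ 2)
      (by fun_prop), integral_sq_chiLaw, mul_comm, integral_haarO_mul, ofLp_dotProduct_ofLp]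

theorem rowTerm_mul_rowTerm_scaleRows (i j : Fin n) (p : O n × (Fin n → ℝ)) :
    rowTerm x y i (scaleRows n p) * rowTerm x y j (scaleRows n p) =
      ((p.1.1 *ᵥ x.ofLp) i * (p.1.1 *ᵥ y.ofLp) i * ((p.1.1 *ᵥ x.ofLp) j * (p.1.1 *ᵥ y.ofLp) j)) *
        (p.2 i ^ 2 * p.2 j ^ 2) := by
  rw [rowTerm_scaleRows, rowTerm_scaleRows]
  ring

theorem integrable_chiLaw_sq_mul_sq (i j : Fin n) :
    Integrable (fun s : Fin n → ℝ => s i ^ 2 * s j ^ 2) (Measure.pi fun _ => chiLaw n) := by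
  by_cases hij : i = j
  · subst hij
    simpa only [← pow_add] using integrable_comp_eval (μ := fun _ : Fin n => chiLaw n) (i := i)
      (integrable_pow_four_chiLaw n)
  · exact integrable_pi_mul (integrable_sq_chiLaw n) (integrable_sq_chiLaw n) hij

theorem integrable_rowTerm_mul_rowTerm_gOrtSquareLaw (i j : Fin n) :
    Integrable (fun M => rowTerm x y i M * rowTerm x y j M) (gOrtSquareLaw n) := by
  have hx := continuous_coe_mulVec n x.ofLp
  have hy := continuous_coe_mulVec n y.ofLp
  rw [gOrtSquareLaw, integrable_map_measure
    (measurable_rowTerm_mul_rowTerm x y i j).aestronglyMeasurable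
    (measurable_scaleRows n).aemeasurable]
  have h := (integrable_haarO (n := n) (f := fun U => (U.1 *ᵥ x.ofLp) i * (U.1 *ᵥ y.ofLp) i *
    ((U.1 *ᵥ x.ofLp) j * (U.1 *ᵥ y.ofLp) j)) (by fun_prop)).mul_prod
    (integrable_chiLaw_sq_mul_sq i j)
  exact h.congr (.of_forall fun p => (rowTerm_mul_rowTerm_scaleRows x y i j p).symm)

theorem integral_rowTerm_mul_rowTerm_gOrtSquareLaw_eq (i j : Fin n) :
    ∫ M, rowTerm x y i M * rowTerm x y j M ∂gOrtSquareLaw n =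
      (∫ U, (U.1 *ᵥ x.ofLp) i * (U.1 *ᵥ y.ofLp) i *
        ((U.1 *ᵥ x.ofLp) j * (U.1 *ᵥ y.ofLp) j) ∂haarO n) *
      ∫ s : Fin n → ℝ, s i ^ 2 * s j ^ 2 ∂(Measure.pi fun _ => chiLaw n) := by
  rw [gOrtSquareLaw, integral_map (measurable_scaleRows n).aemeasurable
    (measurable_rowTerm_mul_rowTerm x y i j).aestronglyMeasurable]
  simp_rw [rowTerm_mul_rowTerm_scaleRows]
  exact integral_prod_mul (fun U : O n => (U.1 *ᵥ x.ofLp) i * (U.1 *ᵥ y.ofLp) i *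
        ((U.1 *ᵥ x.ofLp) j * (U.1 *ᵥ y.ofLp) j)) (fun s : Fin n → ℝ => s i ^ 2 * s j ^ 2)

/-- The chi fourth moment `n (n + 2)` cancels the Haar denominator exactly, giving the same value as
for a Gaussian row. A second index is required because the Haar moment is obtained from a system
involving two distinct coordinates. -/
theorem integral_rowTerm_mul_self_gOrtSquareLaw (hn : 2 ≤ n) (i : Fin n) :
    ∫ M, rowTerm x y i M * rowTerm x y i M ∂gOrtSquareLaw n =
      ‖x‖ ^ 2 * ‖y‖ ^ 2 + 2 * (inner ℝ x y) ^ 2 := by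
  have : Nontrivial (Fin n) := Fin.nontrivial_iff_two_le.2 hn
  obtain ⟨j, hj⟩ := exists_ne i
  have h := integral_haarO_sq_mul_sq x.ofLp y.ofLp hj.symm
  rw [integral_rowTerm_mul_rowTerm_gOrtSquareLaw_eq]
  simp_rw [← pow_add]
  rw [integral_comp_eval (μ := fun _ : Fin n => chiLaw n) (f := fun s : ℝ => s ^ (2 + 2))
    (by fun_prop), integral_pow_four_chiLaw, mul_comm]
  simp only [ofLp_dotProduct_ofLp, real_inner_self_eq_norm_sq] at h
  rw [← h]
  congr 2 with U
  ring

/-- Here the scalings are independent and contribute `n * n`; one factor `n` cancels against the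
Haar denominator. -/
theorem integral_rowTerm_mul_rowTerm_gOrtSquareLaw (hij : i ≠ j) :
    ((n : ℝ) - 1) * (n + 2) * ∫ M, rowTerm x y i M * rowTerm x y j M ∂gOrtSquareLaw n =
      n * (n * (inner ℝ x y) ^ 2 - ‖x‖ ^ 2 * ‖y‖ ^ 2) := by
  have h := integral_haarO_mul_mul_mul x.ofLp y.ofLp hij
  simp only [ofLp_dotProduct_ofLp, real_inner_self_eq_norm_sq] at h
  rw [integral_rowTerm_mul_rowTerm_gOrtSquareLaw_eq,
    integral_pi_mul (integrable_sq_chiLaw n) (integrable_sq_chiLaw n) hij, integral_sq_chiLaw]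
  linear_combination n * h

end OrthogonalRows

/-! ### Rows of the stacked matrix -/

section StackedRows

variable {m n : ℕ} [NeZero n] (x y : EuclideanSpace ℝ (Fin n)) (i j : Fin m)

theorem rowTerm_stackRows (B : Fin m → Matrix (Fin n) (Fin n) ℝ) :
    rowTerm x y i (stackRows m n B) =
      rowTerm x y (Fin.ofNat n i.val) (B ⟨i.val / n, (Nat.div_le_self _ _).trans_lt i.isLt⟩) :=
  rfl

/-- For `i < n` the quotient `i / n` is `0` and the remainder is `i`. Thus all rows lie in block
`0`, and every pair of them has the mixed moment of a single square matrix. -/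
theorem rowTerm_stackRows_of_le (hmn : m ≤ n) (B : Fin m → Matrix (Fin n) (Fin n) ℝ) :
    rowTerm x y i (stackRows m n B) = rowTerm x y (i.castLE hmn) (B ⟨0, i.pos⟩) := by
  have hin : i.val < n := i.isLt.trans_le hmn
  rw [rowTerm_stackRows]
  congr 2
  · ext; simp [Nat.mod_eq_of_lt hin]
  · ext; simp [Nat.div_eq_of_lt hin]

theorem integrable_rowTerm_gOrtLaw : Integrable (rowTerm x y i) (gOrtLaw m n) := by
  rw [gOrtLaw, integrable_map_measure (measurable_rowTerm x y i).aestronglyMeasurable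
    (measurable_stackRows m n).aemeasurable]
  exact integrable_comp_eval (μ := fun _ : Fin m => gOrtSquareLaw n)
    (integrable_rowTerm_gOrtSquareLaw x y (Fin.ofNat n i.val))

theorem integral_rowTerm_gOrtLaw : ∫ M, rowTerm x y i M ∂gOrtLaw m n = inner ℝ x y := by
  rw [gOrtLaw, integral_map (measurable_stackRows m n).aemeasurable
    (measurable_rowTerm x y i).aestronglyMeasurable]
  simp_rw [rowTerm_stackRows]
  rw [integral_comp_eval (μ := fun _ : Fin m => gOrtSquareLaw n)
    (measurable_rowTerm x y _).aestronglyMeasurable, integral_rowTerm_gOrtSquareLaw]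

theorem integrable_rowTerm_mul_rowTerm_gOrtLaw (hmn : m ≤ n) :
    Integrable (fun M => rowTerm x y i M * rowTerm x y j M) (gOrtLaw m n) := by
  rw [gOrtLaw, integrable_map_measure
    (measurable_rowTerm_mul_rowTerm x y i j).aestronglyMeasurable
    (measurable_stackRows m n).aemeasurable]
  refine (integrable_comp_eval (μ := fun _ : Fin m => gOrtSquareLaw n) (i := ⟨0, i.pos⟩)
    (integrable_rowTerm_mul_rowTerm_gOrtSquareLaw x y (i.castLE hmn) (j.castLE hmn))).congr
    (.of_forall fun B => ?_)
  simp only [Function.comp_apply, rowTerm_stackRows_of_le x y _ hmn]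

theorem integral_rowTerm_mul_rowTerm_gOrtLaw (hmn : m ≤ n) :
    ∫ M, rowTerm x y i M * rowTerm x y j M ∂gOrtLaw m n =
      ∫ M, rowTerm x y (i.castLE hmn) M * rowTerm x y (j.castLE hmn) M ∂gOrtSquareLaw n := by
  rw [gOrtLaw, integral_map (measurable_stackRows m n).aemeasurable
    (measurable_rowTerm_mul_rowTerm x y i j).aestronglyMeasurable]
  simp_rw [rowTerm_stackRows_of_le x y _ hmn]
  exact integral_comp_eval (μ := fun _ : Fin m => gOrtSquareLaw n)
    (f := fun M => rowTerm x y (i.castLE hmn) M * rowTerm x y (j.castLE hmn) M)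
    (measurable_rowTerm_mul_rowTerm x y _ _).aestronglyMeasurable

end StackedRows

/-! ### The mean-squared errors -/

section Estimators

variable {m n : ℕ} (x y : EuclideanSpace ℝ (Fin n))

theorem isUnbiased_estimator_gOrtLaw [NeZero n] (hm : 1 ≤ m) :
    IsUnbiased (gOrtLaw m n) (fun M => estimator M x y) (inner ℝ x y) :=
  isUnbiased_average hm (integrable_rowTerm_gOrtLaw x y) (integral_rowTerm_gOrtLaw x y)

theorem integrable_sq_error_gaussianLaw :
    Integrable (fun M => (estimator M x y - inner ℝ x y) ^ 2) (gaussianLaw m n) :=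
  integrable_average_sub_sq (integrable_rowTerm_gaussianLaw x y)
    (integrable_rowTerm_mul_rowTerm_gaussianLaw x y)

theorem integrable_sq_error_gOrtLaw [NeZero n] (hmn : m ≤ n) :
    Integrable (fun M => (estimator M x y - inner ℝ x y) ^ 2) (gOrtLaw m n) :=
  integrable_average_sub_sq (integrable_rowTerm_gOrtLaw x y)
    fun i j => integrable_rowTerm_mul_rowTerm_gOrtLaw x y i j hmn

theorem mse_gaussianLaw (hm : 1 ≤ m) :
    mse (gaussianLaw m n) (fun M => estimator M x y) (inner ℝ x y) =
      (‖x‖ ^ 2 * ‖y‖ ^ 2 + 2 * (inner ℝ x y) ^ 2 + (m - 1) * (inner ℝ x y) ^ 2) / m -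
        (inner ℝ x y) ^ 2 :=
  mse_average hm (integrable_rowTerm_gaussianLaw x y) (integral_rowTerm_gaussianLaw x y)
    (integrable_rowTerm_mul_rowTerm_gaussianLaw x y) (integral_rowTerm_mul_self_gaussianLaw x y)
    fun _ _ => integral_rowTerm_mul_rowTerm_gaussianLaw x y

theorem mse_gOrtLaw [NeZero n] (hm : 1 ≤ m) (hn : 2 ≤ n) (hmn : m ≤ n) :
    mse (gOrtLaw m n) (fun M => estimator M x y) (inner ℝ x y) =
      (‖x‖ ^ 2 * ‖y‖ ^ 2 + 2 * (inner ℝ x y) ^ 2 + (m - 1) *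
        (n * (n * (inner ℝ x y) ^ 2 - ‖x‖ ^ 2 * ‖y‖ ^ 2) / ((n - 1) * (n + 2)))) / m -
        (inner ℝ x y) ^ 2 := by
  have hn1 : (0 : ℝ) < n - 1 := by
    have : (2 : ℝ) ≤ n := by exact_mod_cast hn
    linarith
  refine mse_average hm (integrable_rowTerm_gOrtLaw x y) (integral_rowTerm_gOrtLaw x y)
    (fun i j => integrable_rowTerm_mul_rowTerm_gOrtLaw x y i j hmn) (fun i => ?_)
    fun i j hij => ?_
  · rw [integral_rowTerm_mul_rowTerm_gOrtLaw x y i i hmn,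
      integral_rowTerm_mul_self_gOrtSquareLaw x y hn]
  · rw [integral_rowTerm_mul_rowTerm_gOrtLaw x y i j hmn, eq_div_iff (by positivity), mul_comm]
    exact integral_rowTerm_mul_rowTerm_gOrtSquareLaw x y
      ((Fin.castLE_injective hmn).ne hij)

theorem continuous_estimator :
    Continuous fun M : Matrix (Fin m) (Fin n) ℝ => estimator M x y := by
  simp only [estimator_eq_average]
  exact continuous_const.mul (continuous_finsetSum _ fun i _ => continuous_rowTerm x y i)

end Estimators

/-! ### Transfer along a law -/

section Transfer

variable {Ω X : Type*} [MeasurableSpace Ω] [MeasurableSpace X] {P : Measure Ω} {μ : Measure X}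
  {G : Ω → X} {K : X → ℝ} {v : ℝ}

theorem integrable_comp_of_hasLaw (hG : HasLaw G μ P) (hK : Integrable K μ) :
    Integrable (fun ω => K (G ω)) P := by
  rw [← hG.map_eq] at hK
  exact hK.comp_aemeasurable hG.aemeasurable

theorem IsUnbiased.comp_hasLaw (hG : HasLaw G μ P) (hK : IsUnbiased μ K v) :
    IsUnbiased P (fun ω => K (G ω)) v :=
  ⟨integrable_comp_of_hasLaw hG hK.1,
    (hG.integral_comp hK.1.aestronglyMeasurable).trans hK.2⟩

theorem mse_comp_hasLaw (hG : HasLaw G μ P) (hK : Measurable K) :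
    mse P (fun ω => K (G ω)) v = mse μ K v :=
  hG.integral_comp (f := fun g => (K g - v) ^ 2) (by fun_prop)

end Transfer

end OJLT

theorem theorem1 {Ω Ω' : Type*} [MeasurableSpace Ω] [MeasurableSpace Ω']
    (P : Measure Ω) (P' : Measure Ω') (m n : ℕ) [NeZero n] (hm : 1 ≤ m)
    (G : Ω → Matrix (Fin m) (Fin n) ℝ) (hG : HasLaw G (OJLT.gaussianLaw m n) P)
    (Gort : Ω' → Matrix (Fin m) (Fin n) ℝ) (hGort : HasLaw Gort (OJLT.gOrtLaw m n) P')
    (x y : EuclideanSpace ℝ (Fin n)) :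
    OJLT.IsUnbiased P' (fun ω => OJLT.estimator (Gort ω) x y) (inner ℝ x y) ∧
    (4 ≤ n → m ≤ n →
      Integrable (fun ω => (OJLT.estimator (G ω) x y - inner ℝ x y) ^ 2) P ∧
      Integrable (fun ω => (OJLT.estimator (Gort ω) x y - inner ℝ x y) ^ 2) P' ∧
      OJLT.mse P' (fun ω => OJLT.estimator (Gort ω) x y) (inner ℝ x y) =
        OJLT.mse P (fun ω => OJLT.estimator (G ω) x y) (inner ℝ x y) +
        ((m : ℝ) - 1) / m *
          (‖x‖ ^ 2 * ‖y‖ ^ 2 * n * ((n : ℝ) - 2) / 2 *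
            (1 / (((n : ℝ) + 2) * ((n : ℝ) - 1)) *
                (Real.cos (InnerProductGeometry.angle x y) ^ 2 + 1 / 2) +
              1 / (((n : ℝ) - 1) * ((n : ℝ) - 2)) *
                (Real.cos (InnerProductGeometry.angle x y) ^ 2 - 1 / 2)) -
            (inner ℝ x y) ^ 2)) := by
  have hK := (OJLT.continuous_estimator (m := m) x y).measurable
  have hU := (OJLT.isUnbiased_estimator_gOrtLaw x y hm).comp_hasLaw hGort
  refine ⟨hU, fun hn hmn => ?_⟩
  have hI := OJLT.integrable_comp_of_hasLaw hG (OJLT.integrable_sq_error_gaussianLaw x y)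
  have hI' := OJLT.integrable_comp_of_hasLaw hGort (OJLT.integrable_sq_error_gOrtLaw x y hmn)
  refine ⟨hI, hI', ?_⟩
  -- Substituting `⟨x, y⟩ = cos θ ‖x‖ ‖y‖`, valid also for zero vectors, leaves a rational identity.
  -- Its core is that the bracket's first summand equals `‖x‖²‖y‖² n (n cos² θ - 1) / ((n - 1)(n +
  -- 2))`, the factor `n - 2` cancelling.
  rw [OJLT.mse_comp_hasLaw hG hK, OJLT.mse_comp_hasLaw hGort hK, OJLT.mse_gaussianLaw x y hm,
    OJLT.mse_gOrtLaw x y hm (by omega) hmn, ← InnerProductGeometry.cos_angle_mul_norm_mul_norm x y]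
  have hn4 : (4 : ℝ) ≤ n := by exact_mod_cast hn
  have h1 : (n : ℝ) - 1 ≠ 0 := by linarith
  have h2 : (n : ℝ) - 2 ≠ 0 := by linarith
  have h3 : (n : ℝ) + 2 ≠ 0 := by linarith
  have hm0 : (m : ℝ) ≠ 0 := by positivity
  field_simp
  ring
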